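/- For every integer $t\ge 0$ let $$\mathcal U_{2t}(q)=\sum_{1\le k_1<\cdots<k_t}\frac{q^{k_1+\cdots+k_t}}{(1-q^{k_1})^2\cdots(1-q^{k_t})^2},\qquad \mathcal C_{2t}(q)=\sum_{0<s_1<\cdots<s_t}\frac{q^{2s_1+\cdots+2s_t-t}}{(1-q^{2s_1-1})^2\cdots(1-q^{2s_t-1})^2}$$ be MacMahon's series, where the $k_i$ and $s_i$ are integers and the sums are taken in $\mathbb Z[[q]]$ (so $\mathcal U_0=\mathcal C_0=1$). The sums $\sum_{t\ge0}\mathcal U_{2t}(q)$ and $\sum_{t\ge0}\mathcal C_{2t}(q)$ converge coefficientwise in $\mathbb Z[[q]]$. Write $$\sum_{t\ge0}\mathcal U_{2t}(q)=\sum_{n\ge0}u(n)q^n,\qquad \sum_{t\ge0}\mathcal C_{2t}(q)=\sum_{n\ge0}\kappa(n)q^n .$$ Then for every integer $n\ge0$, $$u(3n+2)\equiv 0 \pmod 3\qquad\text{and}\qquad \kappa(9n+6)\equiv 0\pmod 3 .$$ -/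

import Mathlib

open scoped PowerSeries PowerSeries.WithPiTopology

noncomputable section

/-- The formal power series `q ^ m / (1 - q ^ m) ^ 2` in `ℤ⟦q⟧`, to be used for `m ≥ 1` only, where
the denominator has constant coefficient `1` and `invOfUnit _ 1` is its inverse. -/
def macMahonFactor (m : ℕ) : ℤ⟦X⟧ :=
  PowerSeries.X ^ m * PowerSeries.invOfUnit ((1 - PowerSeries.X ^ m) ^ 2) 1

/-- The summand is the quotient that it is meant to be. -/
theorem macMahonFactor_mul {m : ℕ} (hm : 1 ≤ m) :
    macMahonFactor m * (1 - PowerSeries.X ^ m) ^ 2 = PowerSeries.X ^ m := by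
  have h : PowerSeries.constantCoeff ((1 - (PowerSeries.X : ℤ⟦X⟧) ^ m) ^ 2) = ((1 : ℤˣ) : ℤ) := by
    simp [show m ≠ 0 by omega]
  rw [macMahonFactor, mul_assoc, mul_comm (PowerSeries.invOfUnit _ _),
    PowerSeries.mul_invOfUnit _ _ h, mul_one]

/-- Strictly increasing `t`-tuples `1 ≤ k₁ < ⋯ < k_t`, encoded as the sets `{k₁, …, k_t}` of `t`
positive integers. -/
abbrev IncreasingTuple (t : ℕ) : Type := {s : Finset ℕ+ // s.card = t}

/-- MacMahon's series
`𝒰_{2t}(q) = ∑_{1 ≤ k₁ < ⋯ < k_t} q^{k₁ + ⋯ + k_t} / ((1 - q^{k₁})² ⋯ (1 - q^{k_t})²)`,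
the sum being taken in `ℤ⟦q⟧` with coefficientwise convergence. -/
def macMahonU (t : ℕ) : ℤ⟦X⟧ :=
  ∑' s : IncreasingTuple t, ∏ k ∈ s.1, macMahonFactor (k : ℕ)

/-- MacMahon's series `𝒞_{2t}(q) = ∑_{0 < s₁ < ⋯ < s_t}
q^{2s₁ + ⋯ + 2s_t - t} / ((1 - q^{2s₁-1})² ⋯ (1 - q^{2s_t-1})²)`,
the sum being taken in `ℤ⟦q⟧` with coefficientwise convergence. -/
def macMahonC (t : ℕ) : ℤ⟦X⟧ :=
  ∑' s : IncreasingTuple t, ∏ k ∈ s.1, macMahonFactor (2 * (k : ℕ) - 1)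

/-- The sums that define `macMahonU` and `macMahonC` converge. -/
theorem summable_prod_macMahonFactor (f : ℕ+ → ℕ) (hf : ∀ k : ℕ+, (k : ℕ) ≤ f k) (t : ℕ) :
    Summable fun s : IncreasingTuple t => ∏ k ∈ s.1, macMahonFactor (f k) := by
  refine Pi.summable.2 fun d => ?_
  refine summable_of_hasFiniteSupport ?_
  obtain ⟨n, rfl⟩ : ∃ n, d = Finsupp.single () n := ⟨d (), by ext; simp⟩
  have key : ∀ s : IncreasingTuple t,
      PowerSeries.coeff n (∏ k ∈ s.1, macMahonFactor (f k)) ≠ 0 →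
        s ∈ (Subtype.val : IncreasingTuple t → Finset ℕ+) ⁻¹'
          (↑(Finset.Icc (1 : ℕ+) n.succPNat).powerset : Set (Finset ℕ+)) := by
    intro s hs
    simp only [Set.mem_preimage, Finset.coe_powerset, Set.mem_powerset_iff, Finset.coe_subset]
    intro k hk
    refine Finset.mem_Icc.2 ⟨one_le, ?_⟩
    by_contra hlt
    apply hs
    have h1 : (PowerSeries.X : ℤ⟦X⟧) ^ (f k) ∣ ∏ k ∈ s.1, macMahonFactor (f k) :=
      (Dvd.intro _ rfl : _ ∣ macMahonFactor (f k)).trans (Finset.dvd_prod_of_mem _ hk)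
    refine PowerSeries.X_pow_dvd_iff.1 h1 n ?_
    have h2 : n.succPNat < k := not_le.1 hlt
    have h3 : (n.succPNat : ℕ) < (k : ℕ) := h2
    have h4 := hf k
    simp at h3
    omega
  exact ((Finset.finite_toSet _).preimage Subtype.val_injective.injOn).subset key

theorem summable_macMahonU (t : ℕ) :
    Summable fun s : IncreasingTuple t => ∏ k ∈ s.1, macMahonFactor (k : ℕ) :=
  summable_prod_macMahonFactor (fun k => (k : ℕ)) (fun _ => le_rfl) t

theorem summable_macMahonC (t : ℕ) :
    Summable fun s : IncreasingTuple t => ∏ k ∈ s.1, macMahonFactor (2 * (k : ℕ) - 1) :=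
  summable_prod_macMahonFactor (fun k => 2 * (k : ℕ) - 1) (fun k => by have := k.pos; omega) t

end

/-!
Modulo 3 we have `1 + q ^ k / (1 - q ^ k) ^ 2 = ((1 + q ^ k) / (1 - q ^ k)) ^ 2`, so the generating
functions `U` and `K` of `u` and `κ` become products, which the Jacobi triple product expresses
through `φ = ∑ q ^ (j ^ 2)` and `ψ = ∑ (-1) ^ j * q ^ (j ^ 2)`: they satisfy `U * ψ ^ 2 = 1` and
`K * ψ = φ`. Since `ψ ^ 3 = ψ(q ^ 3)` modulo 3, the 3-dissections of `U` and `K` follow from those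
of `U * ψ ^ 3 = ψ` and `K * ψ ^ 3 = φ * ψ ^ 2`. The first settles `u`, because 2 is not a square
modulo 3. For `κ`, the identity `φ ^ 2 + ψ ^ 2 = 2 * φ(q ^ 2) ^ 2` together with
`φ * ψ = ψ(q ^ 2) ^ 2` gives `φ ^ 4 + ψ ^ 4 = 2` modulo 3. This makes `∑ κ(3 * n) * q ^ n` equal to
`φ ^ 3 * ψ`, whose coefficients at exponents congruent to 2 modulo 3 vanish as before.
-/

open Filter Finset PowerSeries PowerSeries.WithPiTopology Topology

section GaussBinom

variable {R : Type*} [CommRing R]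

/-- The Gaussian binomial coefficient `[n choose k]_p`, defined by the `q`-Pascal rule so that it
makes sense for every `p` in a commutative ring. -/
def gaussBinom (p : R) : ℕ → ℕ → R
  | _, 0 => 1
  | 0, _ + 1 => 0
  | n + 1, k + 1 => p ^ (k + 1) * gaussBinom p n (k + 1) + gaussBinom p n k

variable (p : R)

theorem gaussBinom_zero_right (n : ℕ) : gaussBinom p n 0 = 1 := by
  cases n <;> rfl

theorem gaussBinom_succ_succ (n k : ℕ) :
    gaussBinom p (n + 1) (k + 1) = p ^ (k + 1) * gaussBinom p n (k + 1) + gaussBinom p n k :=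
  rfl

theorem gaussBinom_eq_zero_of_lt {n k : ℕ} (h : n < k) : gaussBinom p n k = 0 := by
  induction n generalizing k with
  | zero => obtain ⟨k, rfl⟩ := Nat.exists_eq_succ_of_ne_zero h.ne'; rfl
  | succ n ih =>
    obtain ⟨k, rfl⟩ := Nat.exists_eq_succ_of_ne_zero (Nat.ne_zero_of_lt h)
    rw [Nat.succ_eq_add_one, gaussBinom_succ_succ, ih (by omega), ih (by omega), mul_zero,
      zero_add]

theorem gaussBinom_self (n : ℕ) : gaussBinom p n n = 1 := by
  induction n with
  | zero => rfl
  | succ n ih => rw [gaussBinom_succ_succ, ih, gaussBinom_eq_zero_of_lt p n.lt_succ_self, mul_zero,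
      zero_add]

theorem gaussBinom_succ_succ' (k l : ℕ) :
    gaussBinom p (k + l + 1) (k + 1) =
      gaussBinom p (k + l) (k + 1) + p ^ l * gaussBinom p (k + l) k := by
  induction k generalizing l with
  | zero =>
    induction l with
    | zero => simp [gaussBinom]
    | succ l ih =>
      simp only [zero_add, gaussBinom_zero_right] at ih ⊢
      have d₁ := gaussBinom_succ_succ p (l + 1) 0
      have d₀ := gaussBinom_succ_succ p l 0
      simp only [zero_add, gaussBinom_zero_right] at d₁ d₀
      linear_combination d₁ - d₀ + p * ih
  | succ k ihk =>
    induction l with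
    | zero => simp [gaussBinom_self, gaussBinom_eq_zero_of_lt]
    | succ l ihl =>
      have h := ihk (l + 1)
      have d₀ := gaussBinom_succ_succ p (k + l + 1 + 1) (k + 1)
      have d₁ := gaussBinom_succ_succ p (k + l + 1) (k + 1)
      have d₂ := gaussBinom_succ_succ p (k + l + 1) k
      rw [show k + 1 + l = k + l + 1 by ring] at ihl
      rw [← add_assoc] at h
      rw [show k + 1 + (l + 1) = k + l + 1 + 1 by ring]
      linear_combination p ^ (k + 2) * ihl + h + d₀ - d₁ - p ^ (l + 1) * d₂

theorem gaussBinom_mul_prod_mul_prod (k l : ℕ) :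
    gaussBinom p (k + l) k * (∏ i ∈ range k, (1 - p ^ (i + 1))) * ∏ i ∈ range l, (1 - p ^ (i + 1)) =
      ∏ i ∈ range (k + l), (1 - p ^ (i + 1)) := by
  induction k generalizing l with
  | zero => simp [gaussBinom_zero_right]
  | succ k ihk =>
    induction l with
    | zero => simp [gaussBinom_self]
    | succ l ihl =>
      have h := ihk (l + 1)
      rw [show k + 1 + (l + 1) = k + 1 + l + 1 by ring, gaussBinom_succ_succ,
        prod_range_succ _ (k + 1 + l), ← ihl]
      rw [show k + (l + 1) = k + 1 + l by ring, ← ihl] at h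
      rw [prod_range_succ _ l] at h ⊢
      rw [prod_range_succ _ k] at h ⊢
      linear_combination (1 - p ^ (k + 1)) * h

variable (q z : R)

theorem add_mul_mul_sum_mul_pow (u v : R) {a : ℕ → R} {n : ℕ} (ha : a (n + 1) = 0) :
    (u + v * z) * ∑ k ∈ range (n + 1), a k * z ^ k =
      ∑ k ∈ range (n + 1), (u * a (k + 1) + v * a k) * z ^ (k + 1) + u * a 0 := by
  have h : ∑ k ∈ range (n + 1), a k * z ^ k =
      ∑ k ∈ range (n + 1), a (k + 1) * z ^ (k + 1) + a 0 := by
    have h₁ := sum_range_succ (fun k => a k * z ^ k) (n + 1)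
    rw [sum_range_succ', ha, zero_mul, add_zero, pow_zero, mul_one] at h₁
    exact h₁.symm
  rw [add_mul]
  nth_rw 1 [h]
  simp only [mul_add, add_mul, sum_add_distrib, mul_sum, pow_succ]
  rw [add_right_comm]
  congr 2 <;> exact sum_congr rfl fun _ _ => by ring

theorem prod_add_pow_eq_sum_gaussBinom (N : ℕ) :
    ∏ i ∈ range N, (z + q ^ (2 * i + 1)) =
      ∑ k ∈ range (N + 1), gaussBinom (q ^ 2) N k * q ^ ((k - N : ℤ).natAbs ^ 2) * z ^ k := by
  induction N with
  | zero => simp [gaussBinom_zero_right]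
  | succ N ih =>
    have h := add_mul_mul_sum_mul_pow z (q ^ (2 * N + 1)) 1
      (a := fun k => gaussBinom (q ^ 2) N k * q ^ ((k - N : ℤ).natAbs ^ 2)) (n := N)
      (by rw [gaussBinom_eq_zero_of_lt _ N.lt_succ_self, zero_mul])
    rw [prod_range_succ, ih, mul_comm, add_comm z]
    rw [one_mul] at h
    rw [h, sum_range_succ' _ (N + 1)]
    congr 1
    · refine sum_congr rfl fun k _ => ?_
      have e₁ : 2 * N + 1 + ((k + 1 : ℕ) - N : ℤ).natAbs ^ 2 =
          2 * (k + 1) + ((k + 1 : ℕ) - (N + 1 : ℕ) : ℤ).natAbs ^ 2 := by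
        zify; simp only [sq_abs]; ring
      have e₂ : (k - N : ℤ).natAbs = ((k + 1 : ℕ) - (N + 1 : ℕ) : ℤ).natAbs := by omega
      have e₃ := congrArg (q ^ ·) e₁
      simp only [pow_add _ (2 * N + 1), pow_add _ (2 * (k + 1)), pow_mul q 2] at e₃
      rw [gaussBinom_succ_succ, e₂]
      linear_combination gaussBinom (q ^ 2) N (k + 1) * z ^ (k + 1) * e₃
    · have e : 2 * N + 1 + ((0 : ℕ) - N : ℤ).natAbs ^ 2 =
          ((0 : ℕ) - (N + 1 : ℕ) : ℤ).natAbs ^ 2 := by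
        zify; simp only [sq_abs]; ring
      rw [gaussBinom_zero_right, gaussBinom_zero_right, ← e, pow_add]
      ring

-- Both sides are multiplied by `z ^ N`, so that `z` need not be invertible.
theorem finite_jacobi_tripleProduct (M N : ℕ) :
    (∏ i ∈ range M, (1 + z * q ^ (2 * i + 1))) * ∏ i ∈ range N, (z + q ^ (2 * i + 1)) =
      ∑ k ∈ range (M + N + 1),
        gaussBinom (q ^ 2) (M + N) k * q ^ ((k - N : ℤ).natAbs ^ 2) * z ^ k := by
  induction M with
  | zero => simpa using prod_add_pow_eq_sum_gaussBinom q z N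
  | succ M ih =>
    have h := add_mul_mul_sum_mul_pow z 1 (q ^ (2 * M + 1))
      (a := fun k => gaussBinom (q ^ 2) (M + N) k * q ^ ((k - N : ℤ).natAbs ^ 2)) (n := M + N)
      (by rw [gaussBinom_eq_zero_of_lt _ (M + N).lt_succ_self, zero_mul])
    rw [prod_range_succ, mul_right_comm, ih, mul_comm, mul_comm z, h,
      show M + 1 + N = M + N + 1 by ring, sum_range_succ' _ (M + N + 1)]
    congr 1
    · refine sum_congr rfl fun k hk => ?_
      obtain ⟨l, hl⟩ := Nat.exists_eq_add_of_le (Nat.le_of_lt_succ (mem_range.1 hk))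
      have e₁ : 2 * M + 1 + (k - N : ℤ).natAbs ^ 2 =
          2 * l + ((k + 1 : ℕ) - N : ℤ).natAbs ^ 2 := by
        zify at hl ⊢; simp only [sq_abs]; linear_combination 2 * hl
      have e₂ := congrArg (q ^ ·) e₁
      simp only [pow_add _ (2 * M + 1), pow_add _ (2 * l), pow_mul q 2] at e₂
      rw [hl, gaussBinom_succ_succ']
      linear_combination gaussBinom (q ^ 2) (k + l) k * z ^ (k + 1) * e₂
    · simp only [gaussBinom_zero_right, one_mul, pow_zero, mul_one]

end GaussBinom

section Adic

variable {R : Type*} [CommRing R]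

theorem tendsto_order_of_X_pow_dvd {ι : Type*} [Preorder ι] {g : ι → ℕ}
    (hg : Tendsto g atTop atTop) {f : ι → R⟦X⟧} (h : ∀ i, X ^ g i ∣ f i) :
    Tendsto (fun i => (f i).order) atTop (𝓝 ⊤) := by
  refine ENat.tendsto_nhds_top_iff_natCast_lt.2 fun n => ?_
  filter_upwards [hg.eventually_gt_atTop n] with i hi
  exact lt_of_lt_of_le (by exact_mod_cast hi) (nat_le_order _ _ (X_pow_dvd_iff.1 (h i)))

variable [TopologicalSpace R]

theorem tendsto_zero_of_X_pow_dvd {f : ℕ → R⟦X⟧} (h : ∀ n, X ^ n ∣ f n) :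
    Tendsto f atTop (𝓝 0) := by
  rw [tendsto_iff_coeff_tendsto]
  intro d
  refine tendsto_const_nhds.congr' ?_
  filter_upwards [eventually_gt_atTop d] with n hn
  rw [X_pow_dvd_iff.1 (h n) d hn, map_zero]

theorem X_pow_dvd_of_tendsto [T2Space R] {f : ℕ → R⟦X⟧} {a : R⟦X⟧} (h : Tendsto f atTop (𝓝 a))
    {m : ℕ} (hf : ∀ᶠ n in atTop, X ^ m ∣ f n) : X ^ m ∣ a := by
  refine X_pow_dvd_iff.2 fun d hd => ?_
  refine tendsto_nhds_unique ((tendsto_iff_coeff_tendsto R f _ a).1 h d)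
    (tendsto_const_nhds.congr' ?_)
  filter_upwards [hf] with n hn
  rw [X_pow_dvd_iff.1 hn d hd]

theorem continuous_of_continuous_coeff {Y : Type*} [TopologicalSpace Y] {F : Y → R⟦X⟧}
    (h : ∀ n, Continuous fun y => coeff n (F y)) : Continuous F :=
  continuous_iff_continuousAt.2 fun _ =>
    (tendsto_iff_coeff_tendsto R _ _ _).2 fun n => (h n).continuousAt

theorem continuous_map {S : Type*} [CommRing S] [TopologicalSpace S] {g : R →+* S}
    (hg : Continuous g) : Continuous (PowerSeries.map g : R⟦X⟧ → S⟦X⟧) :=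
  continuous_of_continuous_coeff fun n => hg.comp (continuous_coeff R n)

theorem continuous_expand {k : ℕ} (hk : k ≠ 0) : Continuous (expand k hk : R⟦X⟧ → R⟦X⟧) := by
  refine continuous_of_continuous_coeff fun n => ?_
  simp only [coeff_expand]
  split_ifs
  · exact continuous_coeff R _
  · exact continuous_const

end Adic

section QProduct

variable {R : Type*} [CommRing R] [TopologicalSpace R]

/-- The infinite product `∏ n, (1 + z * q ^ (m * n + a))`, which is `(-z * q ^ a; q ^ m)_∞` in
Pochhammer notation. It converges for `m ≠ 0`. -/
noncomputable def qProduct (m a : ℕ) (z : R) : R⟦X⟧ :=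
  ∏' n : ℕ, (1 + C z * X ^ (m * n + a))

variable {m : ℕ} (hm : m ≠ 0) (a : ℕ) (z : R)
include hm

theorem multipliable_qProduct : Multipliable fun n : ℕ => 1 + C z * X ^ (m * n + a) :=
  multipliable_one_add_of_tendsto_order_atTop_nhds_top R <|
    tendsto_order_of_X_pow_dvd
      (tendsto_atTop_mono (fun n => (Nat.le_mul_of_pos_left n (Nat.pos_of_ne_zero hm)).trans
        (Nat.le_add_right _ a)) tendsto_id)
      fun _ => dvd_mul_left _ _

variable [T2Space R]

theorem constantCoeff_qProduct {a : ℕ} (ha : a ≠ 0) : constantCoeff (qProduct m a z) = 1 := by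
  rw [qProduct, (multipliable_qProduct hm a z).map_tprod _ (continuous_constantCoeff R)]
  simp [ha]

theorem isUnit_qProduct {a : ℕ} (ha : a ≠ 0) : IsUnit (qProduct m a z) := by
  rw [isUnit_iff_constantCoeff, constantCoeff_qProduct hm z ha]
  exact isUnit_one

theorem expand_qProduct {k : ℕ} (hk : k ≠ 0) :
    expand k hk (qProduct m a z) = qProduct (k * m) (k * a) z := by
  rw [qProduct, (multipliable_qProduct hm a z).map_tprod _ (continuous_expand hk)]
  refine tprod_congr fun n => ?_
  rw [map_add, map_one, map_mul, expand_C, map_pow, expand_X, ← pow_mul, mul_add, mul_assoc]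

variable [IsTopologicalRing R]

theorem qProduct_two_mul_mul_qProduct_two_mul :
    qProduct (2 * m) a z * qProduct (2 * m) (m + a) z = qProduct m a z := by
  have h2m : 2 * m ≠ 0 := by omega
  have h := tprod_even_mul_odd (f := fun n => 1 + C z * X ^ (m * n + a))
    ((multipliable_qProduct h2m a z).congr fun n => by ring)
    ((multipliable_qProduct h2m (m + a) z).congr fun n => by ring)
  rw [qProduct, qProduct, qProduct, ← h]
  congr 1 <;> exact tprod_congr fun n => by ring

theorem qProduct_mul_qProduct_neg :
    qProduct m a z * qProduct m a (-z) = qProduct (2 * m) (2 * a) (-z ^ 2) := by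
  rw [qProduct, qProduct,
    ← (multipliable_qProduct hm a z).tprod_mul (multipliable_qProduct hm a (-z))]
  refine tprod_congr fun n => ?_
  simp only [map_neg, map_pow]
  ring

theorem X_pow_dvd_qProduct_sub_prod (k : ℕ) :
    X ^ (m * k + a) ∣ qProduct m a z - ∏ i ∈ range k, (1 + C z * X ^ (m * i + a)) := by
  refine X_pow_dvd_of_tendsto
    ((multipliable_qProduct hm a z).hasProd.tendsto_prod_nat.sub_const _) ?_
  filter_upwards [eventually_ge_atTop k] with n hn
  induction n, hn using Nat.le_induction with
  | base => rw [sub_self]; exact dvd_zero _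
  | succ n hn ih =>
    have h : (X : R⟦X⟧) ^ (m * k + a) ∣ X ^ (m * n + a) := pow_dvd_pow _ (by gcongr)
    rw [prod_range_succ, mul_add, mul_one, add_sub_right_comm]
    exact dvd_add ih (dvd_mul_of_dvd_right (dvd_mul_of_dvd_right h _) _)

theorem X_pow_dvd_gaussBinom_mul_qProduct_sub_one {j k l : ℕ} (hk : j ≤ k) (hl : j ≤ l) :
    (X : R⟦X⟧) ^ (m * j + m) ∣ gaussBinom (X ^ m) (k + l) k * qProduct m m (-1) - 1 := by
  have hprod (i : ℕ) (hi : j ≤ i) : (X : R⟦X⟧) ^ (m * j + m) ∣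
      qProduct m m (-1) - ∏ n ∈ range i, (1 - (X ^ m) ^ (n + 1)) := by
    refine (pow_dvd_pow _ (by gcongr)).trans
      ((X_pow_dvd_qProduct_sub_prod hm m (-1) i).trans (dvd_of_eq ?_))
    congr 1
    refine prod_congr rfl fun n _ => ?_
    rw [← pow_mul, map_neg, map_one]
    ring
  rw [← (isUnit_qProduct hm (-1) hm).dvd_mul_left]
  obtain ⟨a, ha⟩ := hprod k hk
  obtain ⟨b, hb⟩ := hprod l hl
  obtain ⟨c, hc⟩ := hprod (k + l) (by omega)
  refine ⟨gaussBinom (X ^ m) (k + l) k *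
    (a * qProduct m m (-1) + (∏ i ∈ range k, (1 - (X ^ m) ^ (i + 1))) * b) - c, ?_⟩
  have key := gaussBinom_mul_prod_mul_prod ((X : R⟦X⟧) ^ m) k l
  linear_combination gaussBinom (X ^ m) (k + l) k * (qProduct m m (-1) * ha +
    (∏ i ∈ range k, (1 - (X ^ m) ^ (i + 1))) * hb) - hc + key

end QProduct

section Theta

variable {R : Type*} [CommRing R]

theorem prod_mul_prod_inv_eq_sum_gaussBinom (z : Rˣ) (N : ℕ) :
    (∏ i ∈ range N, (1 + C (z : R) * X ^ (2 * i + 1))) *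
        ∏ i ∈ range N, (1 + C (↑z⁻¹ : R) * X ^ (2 * i + 1)) =
      ∑ j ∈ Icc (-N : ℤ) N, gaussBinom (X ^ 2) (N + N) (N + j).toNat *
        monomial (j.natAbs ^ 2) (↑(z ^ j) : R) := by
  have hz : IsUnit (C (z : R) ^ N) := (z.isUnit.map C).pow N
  refine hz.mul_left_cancel ?_
  calc C (z : R) ^ N * ((∏ i ∈ range N, (1 + C (z : R) * X ^ (2 * i + 1))) *
        ∏ i ∈ range N, (1 + C (↑z⁻¹ : R) * X ^ (2 * i + 1)))
    _ = (∏ i ∈ range N, (1 + C (z : R) * X ^ (2 * i + 1))) *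
        ∏ i ∈ range N, (C (z : R) + X ^ (2 * i + 1)) := by
      rw [mul_left_comm, ← card_range N, ← prod_const, card_range, ← prod_mul_distrib]
      congr 1
      refine prod_congr rfl fun i _ => ?_
      rw [mul_add, mul_one, ← mul_assoc, ← map_mul, Units.mul_inv, map_one, one_mul]
    _ = _ := by
      rw [finite_jacobi_tripleProduct, mul_sum]
      refine sum_nbij' (fun k : ℕ => (k - N : ℤ)) (fun j => (N + j).toNat)
        (fun k hk => ?_) (fun j hj => ?_) (fun k _ => ?_) (fun j hj => ?_) fun k _ => ?_
      · rw [mem_range] at hk; rw [mem_Icc]; omega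
      · rw [mem_Icc] at hj; rw [mem_range]; omega
      · simp only [add_sub_cancel, Int.toNat_natCast]
      · rw [mem_Icc] at hj; omega
      · have hpow : (z : R) ^ k = z ^ N * ↑(z ^ (k - N : ℤ)) := by
          rw [← Units.val_pow_eq_pow_val, ← Units.val_pow_eq_pow_val, ← Units.val_mul,
            ← zpow_natCast z N, ← zpow_add, add_sub_cancel, zpow_natCast]
        rw [add_sub_cancel, Int.toNat_natCast, monomial_eq_C_mul_X_pow, ← map_pow, ← map_pow, hpow,
          map_mul]
        ring

variable [TopologicalSpace R]

/-- The theta series `∑ j : ℤ, z ^ j * q ^ (j ^ 2)`, for `z` invertible so that `z ^ j` makes sense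
for negative `j`. -/
noncomputable def thetaSeries (z : Rˣ) : R⟦X⟧ :=
  ∑' j : ℤ, monomial (j.natAbs ^ 2) (↑(z ^ j) : R)

theorem hasSum_thetaSeries (z : Rˣ) :
    HasSum (fun j : ℤ => monomial (j.natAbs ^ 2) (↑(z ^ j) : R)) (thetaSeries z) := by
  refine Summable.hasSum ((summable_iff_summable_coeff R).2 fun n => ?_)
  refine summable_of_hasFiniteSupport ((Set.finite_Icc (-n : ℤ) n).subset fun j hj => ?_)
  have hn : n = j.natAbs ^ 2 := by
    by_contra h
    exact hj ((coeff_monomial _ _ _).trans (if_neg h))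
  have : j.natAbs ≤ n := hn ▸ Nat.le_self_pow two_ne_zero _
  rw [Set.mem_Icc]
  omega

variable [T2Space R] [IsTopologicalRing R]

theorem jacobi_tripleProduct (z : Rˣ) : thetaSeries z =
    qProduct 2 2 (-1) * (qProduct 2 1 (z : R) * qProduct 2 1 (↑z⁻¹ : R)) := by
  have hsum := (hasSum_thetaSeries z).comp tendsto_Icc_neg
  have hprod := ((multipliable_qProduct two_ne_zero 1 (z : R)).hasProd.tendsto_prod_nat.mul
    (multipliable_qProduct two_ne_zero 1 (↑z⁻¹ : R)).hasProd.tendsto_prod_nat).const_mul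
      (qProduct 2 2 (-1))
  refine tendsto_nhds_unique ?_ hprod
  suffices h : ∀ N : ℕ, X ^ N ∣ qProduct 2 2 (-1) *
      ((∏ i ∈ range N, (1 + C (z : R) * X ^ (2 * i + 1))) *
        ∏ i ∈ range N, (1 + C (↑z⁻¹ : R) * X ^ (2 * i + 1))) -
      ∑ j ∈ Icc (-N : ℤ) N, monomial (j.natAbs ^ 2) (↑(z ^ j) : R) by
    simpa only [Function.comp_apply, sub_add_cancel, zero_add] using
      (tendsto_zero_of_X_pow_dvd h).add hsum
  intro N
  rw [prod_mul_prod_inv_eq_sum_gaussBinom, mul_sum, ← sum_sub_distrib]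
  refine dvd_sum fun j hj => ?_
  rw [mem_Icc] at hj
  have h := X_pow_dvd_gaussBinom_mul_qProduct_sub_one (R := R) two_ne_zero
    (j := N - j.natAbs) (k := (N + j).toNat) (l := (N - j).toNat) (by omega) (by omega)
  rw [show (N + j).toNat + (N - j).toNat = N + N by omega] at h
  have hexp : N ≤ 2 * (N - j.natAbs) + 2 + j.natAbs ^ 2 := by
    have : 2 * j.natAbs ≤ j.natAbs ^ 2 + 1 := by nlinarith [sq_nonneg ((j.natAbs : ℤ) - 1)]
    omega
  refine (pow_dvd_pow _ hexp).trans ?_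
  rw [pow_add, monomial_eq_C_mul_X_pow]
  exact (mul_dvd_mul h (dvd_mul_left _ (C (↑(z ^ j) : R)))).trans (dvd_of_eq (by ring))

end Theta

section Multisect

variable {R : Type*} [CommRing R]

/-- The `r`-th part of the `m`-dissection of a power series: `∑ a n * q ^ n` is sent to
`∑ a (m * n + r) * q ^ n`. -/
noncomputable def multisect (m r : ℕ) : R⟦X⟧ →ₗ[R] R⟦X⟧ where
  toFun f := PowerSeries.mk fun n => coeff (m * n + r) f
  map_add' f g := by ext n; simp
  map_smul' c f := by ext n; simp

theorem coeff_multisect (m r n : ℕ) (f : R⟦X⟧) :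
    coeff n (multisect m r f) = coeff (m * n + r) f := by
  simp [multisect]

theorem continuous_multisect [TopologicalSpace R] (m r : ℕ) :
    Continuous (multisect m r : R⟦X⟧ → R⟦X⟧) :=
  continuous_of_continuous_coeff fun n => by
    simp_rw [coeff_multisect]
    exact continuous_coeff R _

variable {m r : ℕ}

theorem multisect_monomial_mul_add (hm : m ≠ 0) (n : ℕ) (a : R) :
    multisect m r (monomial (m * n + r) a) = monomial n a := by
  ext i
  simp [coeff_multisect, coeff_monomial, hm]

theorem multisect_monomial_eq_zero {d : ℕ} (h : ¬ d ≡ r [MOD m]) (a : R) :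
    multisect m r (monomial d a) = 0 := by
  ext i
  rw [coeff_multisect, coeff_monomial, if_neg, map_zero]
  rintro rfl
  exact h (by simp [Nat.ModEq])

theorem multisect_mul_expand (hm : m ≠ 0) (hr : r < m) (f g : R⟦X⟧) :
    multisect m r (f * expand m hm g) = multisect m r f * g := by
  ext n
  rw [coeff_multisect, coeff_mul, coeff_mul]
  symm
  refine sum_of_injOn (fun ij : ℕ × ℕ => (m * ij.1 + r, m * ij.2)) ?_ ?_ ?_ ?_
  · rintro ⟨i, j⟩ - ⟨i', j'⟩ - h
    simpa [hm] using h
  · rintro ⟨i, j⟩ h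
    simp only [mem_coe, HasAntidiagonal.mem_antidiagonal] at h ⊢
    rw [← h]
    ring
  · rintro ⟨i, j⟩ hij hni
    rw [HasAntidiagonal.mem_antidiagonal] at hij
    refine mul_eq_zero_of_right _ (coeff_expand_of_not_dvd m hm _ ?_)
    rintro ⟨j, rfl⟩
    have hjn : j ≤ n := by
      by_contra! h
      nlinarith
    refine hni ⟨(n - j, j), ?_, ?_⟩
    · simpa using Nat.sub_add_cancel hjn
    · obtain ⟨k, rfl⟩ := Nat.exists_eq_add_of_le hjn
      simp only [Nat.add_sub_cancel_left, Prod.mk.injEq, and_true]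
      linarith
  · rintro ⟨i, j⟩ -
    rw [coeff_multisect, coeff_expand_mul]

theorem sum_X_pow_mul_expand_multisect (hm : m ≠ 0) (f : R⟦X⟧) :
    ∑ i ∈ range m, X ^ i * expand m hm (multisect m i f) = f := by
  ext n
  have hmod : n % m < m := Nat.mod_lt n (Nat.pos_of_ne_zero hm)
  rw [map_sum, sum_eq_single_of_mem _ (mem_range.2 hmod)]
  · nth_rw 1 [← Nat.div_add_mod n m]
    rw [coeff_X_pow_mul, coeff_expand_mul, coeff_multisect, Nat.div_add_mod]
  · intro i hi hin
    rw [coeff_X_pow_mul']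
    split_ifs with h
    · refine coeff_expand_of_not_dvd m hm _ fun hdvd => hin ?_
      have := (Nat.modEq_iff_dvd' h).2 hdvd
      rwa [Nat.ModEq, Nat.mod_eq_of_lt (mem_range.1 hi)] at this
    · rfl

theorem multisect_X_pow {i : ℕ} (hi : i < m) (hr : r < m) :
    multisect m r (X ^ i : R⟦X⟧) = if i = r then 1 else 0 := by
  rw [X_pow_eq]
  split_ifs with h
  · simpa [h] using multisect_monomial_mul_add (r := r) (Nat.ne_zero_of_lt hr) 0 (1 : R)
  · refine multisect_monomial_eq_zero ?_ 1
    rwa [Nat.ModEq, Nat.mod_eq_of_lt hi, Nat.mod_eq_of_lt hr]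

theorem expand_eq_pow {p : ℕ} [hp : Fact p.Prime] (f : (ZMod p)⟦X⟧) :
    expand p hp.out.ne_zero f = f ^ p := by
  have h := MvPowerSeries.map_frobenius_expand p hp.out.ne_zero (f := f)
  rw [ZMod.frobenius_zmod] at h
  exact (congrFun (congrArg DFunLike.coe MvPowerSeries.map_id) _).symm.trans h

variable [TopologicalSpace R] [T2Space R]

theorem multisect_thetaSeries_eq_zero (h : ¬ IsSquare (r : ZMod m)) (z : Rˣ) :
    multisect m r (thetaSeries z) = 0 := by
  refine ((hasSum_thetaSeries z).map (multisect m r) (continuous_multisect m r)).unique ?_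
  convert hasSum_zero using 2 with j
  refine multisect_monomial_eq_zero (fun hj => h ⟨(j.natAbs : ZMod m), ?_⟩) _
  rw [← (ZMod.natCast_eq_natCast_iff _ _ _).2 hj, Nat.cast_pow, sq]

theorem multisect_zero_thetaSeries {p : ℕ} (hp : p.Prime) (z : Rˣ) :
    multisect p 0 (thetaSeries z) = expand p hp.ne_zero (thetaSeries (z ^ p)) := by
  have hinj : Function.Injective fun j : ℤ => p * j :=
    mul_right_injective₀ (by exact_mod_cast hp.ne_zero)
  refine ((hasSum_thetaSeries z).map (multisect p 0) (continuous_multisect p 0)).unique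
    ((hinj.hasSum_iff fun j hj => multisect_monomial_eq_zero (fun h => hj ?_) _).1 ?_)
  · obtain ⟨i, hi⟩ := Int.natCast_dvd.2 (hp.dvd_of_dvd_pow (Nat.modEq_zero_iff_dvd.1 h))
    exact ⟨i, hi.symm⟩
  · refine ((hasSum_thetaSeries (z ^ p)).map (expand p hp.ne_zero)
      (continuous_expand hp.ne_zero)).congr_fun fun j => ?_
    have hsq : (p * j).natAbs ^ 2 = p * (p * j.natAbs ^ 2) + 0 := by
      rw [Int.natAbs_mul, Int.natAbs_natCast]
      ring
    simp only [Function.comp_apply]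
    rw [hsq, multisect_monomial_mul_add hp.ne_zero, expand_monomial, zpow_mul, zpow_natCast]

end Multisect

section ThetaIdentities

variable {R : Type*} [CommRing R]

theorem eq_zero_of_eq_mul_expand {k : ℕ} (hk : 1 < k) {f g : R⟦X⟧} (hf : constantCoeff f = 0)
    (h : f = g * expand k (Nat.ne_zero_of_lt hk) f) : f = 0 := by
  have hdvd (n : ℕ) : X ^ (n + 1) ∣ f := by
    induction n with
    | zero => rwa [zero_add, pow_one, X_dvd_iff]
    | succ n ih =>
      obtain ⟨a, ha⟩ := ih
      rw [h, ha, map_mul, map_pow, expand_X, ← pow_mul]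
      exact ((pow_dvd_pow X (by nlinarith)).mul_right _).mul_left _
  ext n
  rw [X_pow_dvd_iff.1 (hdvd n) n n.lt_succ_self, map_zero]

variable [TopologicalSpace R] [T2Space R]

theorem thetaSeries_add_thetaSeries_neg [IsTopologicalRing R] (z : Rˣ) :
    thetaSeries z + thetaSeries (-z) =
      2 * expand 2 two_ne_zero (expand 2 two_ne_zero (thetaSeries (z ^ 2))) := by
  have hinj : Function.Injective fun i : ℤ => 2 * i := mul_right_injective₀ two_ne_zero
  have hexp := (((hasSum_thetaSeries (z ^ 2)).map (expand 2 two_ne_zero)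
    (continuous_expand two_ne_zero)).map (expand 2 two_ne_zero)
      (continuous_expand two_ne_zero)).mul_left 2
  refine ((hasSum_thetaSeries z).add (hasSum_thetaSeries (-z))).unique
    ((hinj.hasSum_iff fun j hj => ?_).1 (hexp.congr_fun fun i => ?_))
  · have hodd : Odd j := Int.not_even_iff_odd.1 fun h => hj (h.two_dvd.imp fun _ => Eq.symm)
    rw [← map_add, hodd.neg_zpow, Units.val_neg, add_neg_cancel, map_zero]
  · have hsq : (2 * i).natAbs ^ 2 = 2 * (2 * i.natAbs ^ 2) := by
      rw [Int.natAbs_mul, mul_pow, ← mul_assoc]; rfl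
    simp only [Function.comp_apply]
    rw [expand_monomial, expand_monomial, (even_two_mul i).neg_zpow, hsq, zpow_mul, ← two_mul]
    rfl

variable [IsTopologicalRing R]

theorem constantCoeff_thetaSeries (z : Rˣ) : constantCoeff (thetaSeries z) = 1 := by
  simp only [jacobi_tripleProduct, map_mul, constantCoeff_qProduct two_ne_zero _ two_ne_zero,
    constantCoeff_qProduct two_ne_zero _ one_ne_zero, mul_one]

theorem thetaSeries_mul_thetaSeries_neg (z : Rˣ) :
    thetaSeries z * thetaSeries (-z) =
      expand 2 two_ne_zero (thetaSeries (-z ^ 2) * thetaSeries (-1)) := by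
  simp only [jacobi_tripleProduct, map_mul, expand_qProduct two_ne_zero, inv_neg, inv_one,
    Units.val_neg, Units.val_one, ← inv_pow, Units.val_pow_eq_pow_val]
  have hz := qProduct_mul_qProduct_neg two_ne_zero 1 (z : R)
  have hz' := qProduct_mul_qProduct_neg two_ne_zero 1 (↑z⁻¹ : R)
  have hsplit := qProduct_two_mul_mul_qProduct_two_mul two_ne_zero 2 (-1 : R)
  norm_num only at hz hz' hsplit ⊢
  rw [← hz, ← hz', ← hsplit]
  ring

theorem thetaSeries_neg_one_mul_qProduct :
    thetaSeries (-1 : Rˣ) * qProduct 1 1 1 = qProduct 1 1 (-1) := by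
  have hpair := qProduct_mul_qProduct_neg one_ne_zero 1 (1 : R)
  have hsplit := qProduct_two_mul_mul_qProduct_two_mul one_ne_zero 1 (-1 : R)
  norm_num only at hpair hsplit
  rw [jacobi_tripleProduct, inv_neg, inv_one, Units.val_neg, Units.val_one]
  linear_combination (qProduct 2 1 (-1) * qProduct 1 1 1 + 1) * hsplit + qProduct 2 1 (-1) * hpair

theorem thetaSeries_sq_add_thetaSeries_neg_one_sq :
    thetaSeries (1 : Rˣ) ^ 2 + thetaSeries (-1 : Rˣ) ^ 2 =
      2 * expand 2 two_ne_zero (thetaSeries (1 : Rˣ)) ^ 2 := by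
  have hadd := thetaSeries_add_thetaSeries_neg (1 : Rˣ)
  have hmul := thetaSeries_mul_thetaSeries_neg (1 : Rˣ)
  rw [one_pow] at hadd
  rw [one_pow, map_mul] at hmul
  refine sub_eq_zero.1 (eq_zero_of_eq_mul_expand one_lt_two (g := -2) ?_ ?_)
  · simp only [map_sub, map_add, map_mul, map_pow, map_ofNat, constantCoeff_expand,
      constantCoeff_thetaSeries]
    norm_num
  · have hadd₂ := congrArg (expand 2 two_ne_zero) hadd
    simp only [map_sub, map_add, map_mul, map_pow, map_ofNat] at hadd₂ ⊢
    set φ := thetaSeries (1 : Rˣ)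
    set ψ := thetaSeries (-1 : Rˣ)
    linear_combination (φ + ψ + 2 * expand 2 two_ne_zero (expand 2 two_ne_zero φ)) * hadd - 2 * hmul

end ThetaIdentities

section ModThree

instance charP_powerSeries {R : Type*} [CommRing R] (p : ℕ) [CharP R p] : CharP R⟦X⟧ p :=
  charP_of_injective_ringHom C_injective p

theorem three_eq_zero : (3 : (ZMod 3)⟦X⟧) = 0 :=
  CharP.cast_eq_zero _ 3

theorem multisect_mul_pow {p : ℕ} [hp : Fact p.Prime] {r : ℕ} (hr : r < p) (f g : (ZMod p)⟦X⟧) :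
    multisect p r (f * g ^ p) = multisect p r f * g := by
  rw [← expand_eq_pow, multisect_mul_expand hp.out.ne_zero hr]

theorem multisect_zero_thetaSeries_zmod {p : ℕ} [hp : Fact p.Prime] (z : (ZMod p)ˣ) :
    multisect p 0 (thetaSeries z) = thetaSeries z ^ p := by
  have hz : z ^ p = z := Units.ext (ZMod.pow_card _)
  rw [multisect_zero_thetaSeries hp.out, hz, expand_eq_pow]

local notation "φ" => thetaSeries (1 : (ZMod 3)ˣ)
local notation "ψ" => thetaSeries (-1 : (ZMod 3)ˣ)

theorem multisect_three_two_thetaSeries (z : (ZMod 3)ˣ) : multisect 3 2 (thetaSeries z) = 0 :=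
  multisect_thetaSeries_eq_zero (by decide) z

theorem thetaSeries_eq_pow_nine_add (z : (ZMod 3)ˣ) :
    thetaSeries z = thetaSeries z ^ 9 + X * multisect 3 1 (thetaSeries z) ^ 3 := by
  have h := sum_X_pow_mul_expand_multisect three_ne_zero (thetaSeries z)
  simp only [expand_eq_pow, sum_range_succ, range_zero, sum_empty,
    multisect_zero_thetaSeries_zmod, multisect_three_two_thetaSeries] at h
  linear_combination -h

theorem thetaSeries_pow_four_add : φ ^ 4 + ψ ^ 4 = 2 := by
  have hadd := thetaSeries_sq_add_thetaSeries_neg_one_sq (R := ZMod 3)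
  have hmul := thetaSeries_mul_thetaSeries_neg (1 : (ZMod 3)ˣ)
  rw [one_pow, map_mul] at hmul
  refine sub_eq_zero.1 (eq_zero_of_eq_mul_expand one_lt_two (g := 1) ?_ ?_)
  · simp only [map_sub, map_add, map_pow, map_ofNat, constantCoeff_thetaSeries]
    norm_num
  · simp only [map_sub, map_add, map_pow, map_ofNat]
    set φ₂ := expand 2 two_ne_zero φ
    set ψ₂ := expand 2 two_ne_zero ψ
    linear_combination (φ ^ 2 + ψ ^ 2 + 2 * φ₂ ^ 2) * hadd - 2 * (φ * ψ + ψ₂ * ψ₂) * hmul +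
      (φ₂ ^ 4 - ψ₂ ^ 4) * three_eq_zero

theorem multisect_zero_mul_sq {a b W V : (ZMod 3)⟦X⟧} (ha : a = a ^ 9 + X * W ^ 3)
    (hb : b = b ^ 9 + X * V ^ 3) :
    multisect 3 0 (a * b ^ 2) = a ^ 3 * b ^ 6 + X * W * V ^ 2 := by
  -- As cubes are series in `X ^ 3`, this is the 3-dissection of `a * b ^ 2`.
  have hsplit : a * b ^ 2 = X ^ 0 * (a ^ 3 * b ^ 6 + X * W * V ^ 2) ^ 3 +
      X ^ 1 * (W * b ^ 6 - a ^ 3 * b ^ 3 * V) ^ 3 +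
      X ^ 2 * (a ^ 3 * V ^ 2 - W * b ^ 3 * V) ^ 3 := by
    simp only [add_pow_char, sub_pow_char]
    linear_combination b ^ 2 * ha + (a ^ 9 + X * W ^ 3) * (b + b ^ 9 + X * V ^ 3) * hb +
      (X * a ^ 9 * b ^ 9 * V ^ 3 + X ^ 2 * W ^ 3 * b ^ 9 * V ^ 3) * three_eq_zero
  rw [hsplit, map_add, map_add]
  simp only [multisect_mul_pow three_pos]
  rw [multisect_X_pow (by norm_num) three_pos, multisect_X_pow (by norm_num) three_pos,
    multisect_X_pow (by norm_num) three_pos]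
  simp

theorem sq_mul_pow_four_add_of_add_eq_two {s t : (ZMod 3)⟦X⟧} (h : s + t = 2) :
    s ^ 2 * t ^ 4 + (1 - s ^ 2) * (1 - t ^ 2) ^ 2 = s ^ 2 * t := by
  linear_combination (s - t - 1) * (2 * t ^ 2 - t - 1) * h +
    ((s - t - 1) * (2 * t ^ 2 - t - 1) + t ^ 4 + t ^ 3 - t ^ 2 - t) * three_eq_zero

theorem multisect_zero_theta_mul_sq : multisect 3 0 (φ * ψ ^ 2) = φ ^ 3 * ψ ^ 2 := by
  have hφ := thetaSeries_eq_pow_nine_add (1 : (ZMod 3)ˣ)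
  have hψ := thetaSeries_eq_pow_nine_add (-1 : (ZMod 3)ˣ)
  have hsect := multisect_zero_mul_sq hφ hψ
  set W := multisect 3 1 φ
  set V := multisect 3 1 ψ
  have hW : X * W ^ 3 = φ * (1 - (φ ^ 4) ^ 2) := by linear_combination -hφ
  have hV : X * V ^ 3 = ψ * (1 - (ψ ^ 4) ^ 2) := by linear_combination -hψ
  refine frobenius_inj _ 3 ?_
  rw [frobenius_def, frobenius_def, hsect]
  calc (φ ^ 3 * ψ ^ 6 + X * W * V ^ 2) ^ 3
    _ = φ ^ 9 * ψ ^ 18 + X * W ^ 3 * (X * V ^ 3) ^ 2 := by rw [add_pow_char]; ring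
    _ = φ * ψ ^ 2 *
        ((φ ^ 4) ^ 2 * (ψ ^ 4) ^ 4 + (1 - (φ ^ 4) ^ 2) * (1 - (ψ ^ 4) ^ 2) ^ 2) := by
      rw [hW, hV]; ring
    _ = φ * ψ ^ 2 * ((φ ^ 4) ^ 2 * ψ ^ 4) := by
      rw [sq_mul_pow_four_add_of_add_eq_two thetaSeries_pow_four_add]
    _ = (φ ^ 3 * ψ ^ 2) ^ 3 := by ring

theorem multisect_two_eq_zero_of_mul_sq_eq_one {F : (ZMod 3)⟦X⟧} (hF : F * ψ ^ 2 = 1) :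
    multisect 3 2 F = 0 := by
  have hψ : ψ ≠ 0 := by rintro h; simp [h] at hF
  refine (mul_eq_zero.1 ?_).resolve_right hψ
  calc multisect 3 2 F * ψ = multisect 3 2 (F * ψ ^ 3) := (multisect_mul_pow (by norm_num) _ _).symm
    _ = multisect 3 2 ψ := by congr 1; linear_combination ψ * hF
    _ = 0 := multisect_three_two_thetaSeries _

theorem multisect_two_multisect_zero_eq_zero_of_mul_eq {F : (ZMod 3)⟦X⟧} (hF : F * ψ = φ) :
    multisect 3 2 (multisect 3 0 F) = 0 := by
  have hψ : ψ ≠ 0 := by rintro h; simpa [h] using constantCoeff_thetaSeries (-1 : (ZMod 3)ˣ)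
  have hF₀ : multisect 3 0 F = φ ^ 3 * ψ := by
    refine mul_right_cancel₀ hψ ?_
    calc multisect 3 0 F * ψ = multisect 3 0 (F * ψ ^ 3) :=
          (multisect_mul_pow (by norm_num) _ _).symm
      _ = multisect 3 0 (φ * ψ ^ 2) := by congr 1; linear_combination ψ ^ 2 * hF
      _ = φ ^ 3 * ψ * ψ := by rw [multisect_zero_theta_mul_sq]; ring
  rw [hF₀, mul_comm, multisect_mul_pow (by norm_num), multisect_three_two_thetaSeries, zero_mul]

end ModThree

section MacMahon

theorem summable_tsum_prod_and_hasProd {f : ℕ+ → ℕ} (hf : ∀ k : ℕ+, (k : ℕ) ≤ f k) :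
    Summable (fun t => ∑' s : IncreasingTuple t, ∏ k ∈ s.1, macMahonFactor (f k)) ∧
      HasProd (fun k => 1 + macMahonFactor (f k))
        (∑' t, ∑' s : IncreasingTuple t, ∏ k ∈ s.1, macMahonFactor (f k)) := by
  have hs : Summable fun s : Finset ℕ+ => ∏ k ∈ s, macMahonFactor (f k) :=
    summable_prod_of_tendsto_order_atTop_nhds_top ℤ
      (tendsto_order_of_X_pow_dvd tendsto_PNat_val_atTop_atTop fun k =>
        (pow_dvd_pow _ (hf k)).trans (Dvd.intro _ rfl))
  have h := ((Equiv.sigmaFiberEquiv (Finset.card (α := ℕ+))).hasSum_iff.2 hs.hasSum).sigma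
    fun t => (summable_prod_macMahonFactor f hf t).hasSum
  exact ⟨h.summable, hasProd_one_add_of_hasSum_prod (h.tsum_eq ▸ hs.hasSum)⟩

theorem map_one_add_macMahonFactor_mul {m : ℕ} (hm : 1 ≤ m) :
    PowerSeries.map (Int.castRingHom (ZMod 3)) (1 + macMahonFactor m) * (1 - X ^ m) ^ 2 =
      (1 + X ^ m) ^ 2 := by
  have h := congrArg (PowerSeries.map (Int.castRingHom (ZMod 3))) (macMahonFactor_mul hm)
  simp only [map_mul, map_pow, map_sub, map_one, map_X, map_add] at h ⊢
  linear_combination h - X ^ m * three_eq_zero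

theorem map_mul_qProduct_sq_of_hasProd {m a : ℕ} (hm : m ≠ 0) (ha : 1 ≤ a) {F : ℤ⟦X⟧}
    (hF : HasProd (fun k : ℕ+ => 1 + macMahonFactor (m * k.natPred + a)) F) :
    PowerSeries.map (Int.castRingHom (ZMod 3)) F * qProduct m a (-1) ^ 2 = qProduct m a 1 ^ 2 := by
  have h := Equiv.pnatEquivNat.symm.hasProd_iff.2 (hF.map
    (PowerSeries.map (Int.castRingHom (ZMod 3))) (continuous_map continuous_of_discreteTopology))
  have hneg := multipliable_qProduct hm a (-1 : ZMod 3)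
  rw [qProduct, qProduct, ← hneg.tprod_pow, ← (multipliable_qProduct hm a _).tprod_pow,
    ← h.tprod_eq, ← h.multipliable.tprod_mul (hneg.pow 2)]
  refine tprod_congr fun n => ?_
  simp only [Function.comp_apply, Equiv.pnatEquivNat_symm_apply, Nat.natPred_succPNat, map_neg,
    map_one, one_mul, neg_mul, ← sub_eq_add_neg]
  exact map_one_add_macMahonFactor_mul (by omega)

theorem modEq_zero_of_coeff_map_mk {a : ℕ → ℤ} {p n : ℕ}
    (h : coeff n (PowerSeries.map (Int.castRingHom (ZMod p)) (PowerSeries.mk a)) = 0) :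
    a n ≡ 0 [ZMOD p] := by
  refine (ZMod.intCast_eq_intCast_iff _ _ p).1 ?_
  simpa using h

theorem multisect_two_map_eq_zero {F : ℤ⟦X⟧}
    (hF : HasProd (fun k : ℕ+ => 1 + macMahonFactor k) F) :
    multisect 3 2 (PowerSeries.map (Int.castRingHom (ZMod 3)) F) = 0 := by
  refine multisect_two_eq_zero_of_mul_sq_eq_one ?_
  have h := map_mul_qProduct_sq_of_hasProd one_ne_zero le_rfl
    (by simpa only [one_mul, PNat.natPred_add_one] using hF)
  rw [← thetaSeries_neg_one_mul_qProduct, mul_pow, ← mul_assoc] at h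
  have hu := (isUnit_qProduct one_ne_zero (1 : ZMod 3) one_ne_zero).pow 2
  exact hu.mul_right_cancel (h.trans (one_mul _).symm)

theorem multisect_two_multisect_zero_map_eq_zero {F : ℤ⟦X⟧}
    (hF : HasProd (fun k : ℕ+ => 1 + macMahonFactor (2 * k - 1)) F) :
    multisect 3 2 (multisect 3 0 (PowerSeries.map (Int.castRingHom (ZMod 3)) F)) = 0 := by
  refine multisect_two_multisect_zero_eq_zero_of_mul_eq ?_
  have h := map_mul_qProduct_sq_of_hasProd two_ne_zero le_rfl (F := F) (by
    convert hF using 4 with k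
    have := PNat.natPred_add_one k
    omega)
  simp only [jacobi_tripleProduct, inv_neg, inv_one, Units.val_neg, Units.val_one]
  linear_combination qProduct 2 2 (-1) * h

end MacMahon

theorem corollary5p3 :
    Summable macMahonU ∧ Summable macMahonC ∧
    ∀ u κ : ℕ → ℤ,
      ∑' t, macMahonU t = PowerSeries.mk u →
      ∑' t, macMahonC t = PowerSeries.mk κ →
      (∀ n : ℕ, u (3 * n + 2) ≡ 0 [ZMOD 3]) ∧ (∀ n : ℕ, κ (9 * n + 6) ≡ 0 [ZMOD 3]) := by
  obtain ⟨hU, hUprod⟩ : Summable macMahonU ∧ HasProd _ (∑' t, macMahonU t) :=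
    summable_tsum_prod_and_hasProd (f := fun k => k) fun _ => le_rfl
  obtain ⟨hC, hCprod⟩ : Summable macMahonC ∧ HasProd _ (∑' t, macMahonC t) :=
    summable_tsum_prod_and_hasProd (f := fun k => 2 * (k : ℕ) - 1)
      fun k => by have := k.pos; omega
  refine ⟨hU, hC, fun u κ hu hκ => ⟨fun n => ?_, fun n => ?_⟩⟩
  · refine modEq_zero_of_coeff_map_mk (p := 3) ?_
    rw [← coeff_multisect, ← hu, multisect_two_map_eq_zero hUprod, map_zero]
  · refine modEq_zero_of_coeff_map_mk (p := 3) ?_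
    rw [show 9 * n + 6 = 3 * (3 * n + 2) + 0 by ring, ← coeff_multisect, ← coeff_multisect, ← hκ,
      multisect_two_multisect_zero_map_eq_zero hCprod, map_zero]
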